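/- Let $m\ge 4$ be even, let $e$ be a positive integer with $\gcd(m,e)=1$, let $q=2^m$, and let $\mathrm{Tr}$ denote the trace from $\mathrm{GF}(q)$ to $\mathrm{GF}(2)$. Let $$\mathcal C=\left\{\left(\mathrm{Tr}(a x^{2^e+1}+bx+c)\right)_{x\in \mathrm{GF}(q)} : a,b,c\in \mathrm{GF}(q)\right\},$$ a binary linear code of length $q$ whose coordinate positions are the elements of $\mathrm{GF}(q)$. Let $T=\mathrm{GF}(4)=\{0,1,w,w^2\}\subseteq \mathrm{GF}(q)$, where $w$ is a generator of $\mathrm{GF}(4)^*$, and let $\mathcal C_T$ be the shortened code of $\mathcal C$ on $T$, that is, the code obtained from the codewords of $\mathcal C$ that are $0$ on $T$ by deleting the coordinates in $T$. Then $\mathcal C_T$ is a $[2^m-4,\ 2m-3,\ 2^{m-1}-2^{m/2}]$ binary linear code (length, dimension, minimum Hamming distance), and the numbers $A_i$ of codewords of Hamming weight $i$ in $\mathcal C_T$ are $$\begin{aligned} A_0&=1,\\ A_{2^{m-1}-2^{m/2}}&=\tfrac13\, 2^{m/2-6}\left(-16+2^{3m/2}-2^{m+1}\left(-4+(-1)^{m/2}\right)-2^{4+m/2}\left(-1+(-1)^{m/2}\right)\right),\\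 A_{2^{m-1}-2^{(m-2)/2}}&=\tfrac1{24}\left(2^{m/2+2}+2^m\right)\left(2^m+(-1)^{m/2}2^{m/2}-2\right),\\ A_{2^{m-1}}&=-1+2^{2m-5}-(-1)^{m/2}2^{3m/2-4},\\ A_{2^{m-1}+2^{(m-2)/2}}&=\tfrac1{24}\left(-2^{m/2+2}+2^m\right)\left(2^m+(-1)^{m/2}2^{m/2}-2\right),\\ A_{2^{m-1}+2^{m/2}}&=\tfrac13\, 2^{m/2-6}\left(16+2^{3m/2}-2^{m+1}\left(4+(-1)^{m/2}\right)+2^{4+m/2}\left(1+(-1)^{m/2}\right)\right), \end{aligned}$$ and $A_i=0$ for every other $i$. -/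

import Mathlib

/-- The code `{(Tr(a f(x) + b x + c))_{x ∈ F} : a, b, c ∈ F}` over the prime field `GF(p)`, of
length `|F|`, whose coordinate positions are the elements of the finite field `F`; here `Tr` is the
trace from `F` to `GF(p)`. -/
noncomputable def traceCode (p : ℕ) [Fact p.Prime] {F : Type*} [Field F] [Algebra (ZMod p) F]
    (f : Polynomial F) : Submodule (ZMod p) (F → ZMod p) where
  carrier := {v | ∃ a b c : F, v = fun x => Algebra.trace (ZMod p) F (a * f.eval x + b * x + c)}
  add_mem' := by
    rintro _ _ ⟨a, b, c, rfl⟩ ⟨a', b', c', rfl⟩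
    refine ⟨a + a', b + b', c + c', funext fun x => ?_⟩
    rw [Pi.add_apply, ← map_add]
    congr 1
    ring
  zero_mem' := ⟨0, 0, 0, funext fun x => by simp⟩
  smul_mem' := by
    rintro r _ ⟨a, b, c, rfl⟩
    refine ⟨r • a, r • b, r • c, funext fun x => ?_⟩
    rw [Pi.smul_apply, ← map_smul]
    simp only [smul_add, smul_mul_assoc]

/-- The punctured code `C^T`: delete the coordinates in `T` from every codeword. -/
def puncturedCode {R ι : Type*} [Semiring R] (C : Submodule R (ι → R)) (T : Finset ι) :
    Submodule R ({i : ι // i ∉ T} → R) :=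
  C.map (LinearMap.funLeft R R (Subtype.val : {i : ι // i ∉ T} → ι))

/-- The subcode `C(T)` of the codewords that are zero on `T`. -/
def vanishingSubcode {R ι : Type*} [Semiring R] (C : Submodule R (ι → R)) (T : Finset ι) :
    Submodule R (ι → R) where
  carrier := {v | v ∈ C ∧ ∀ i ∈ T, v i = 0}
  add_mem' := by
    rintro v w ⟨hv, hv'⟩ ⟨hw, hw'⟩
    exact ⟨C.add_mem hv hw, fun i hi => by simp [hv' i hi, hw' i hi]⟩
  zero_mem' := ⟨C.zero_mem, fun _ _ => rfl⟩
  smul_mem' := by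
    rintro r v ⟨hv, hv'⟩
    exact ⟨C.smul_mem r hv, fun i hi => by simp [hv' i hi]⟩

/-- The shortened code `C_T`: puncture `C(T)` on `T`. -/
def shortenedCode {R ι : Type*} [Semiring R] (C : Submodule R (ι → R)) (T : Finset ι) :
    Submodule R ({i : ι // i ∉ T} → R) :=
  puncturedCode (vanishingSubcode C T) T

/-- `C` is an `[n, k, d]` linear code: it has length `n`, dimension `k`, and minimum Hamming
distance (between distinct codewords) equal to `d`. -/
def HasCodeParameters {R ι : Type*} [Field R] [DecidableEq R] [Fintype ι]
    (C : Submodule R (ι → R)) (n k d : ℕ) : Prop :=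
  Fintype.card ι = n ∧ Module.finrank R C = k ∧
    IsLeast {δ : ℕ | ∃ u ∈ C, ∃ v ∈ C, u ≠ v ∧ hammingDist u v = δ} d

/-- The number `A_w(C)` of codewords of Hamming weight `w`. -/
noncomputable def weightMultiplicity {R ι : Type*} [Semiring R] [DecidableEq R] [Fintype ι]
    (C : Submodule R (ι → R)) (w : ℕ) : ℕ :=
  {v : ι → R | v ∈ C ∧ hammingNorm v = w}.ncard

/-! Since `m` is even and prime to `e`, `e` is odd, so `3 ∣ 2 ^ e + 1` and `t ^ (2 ^ e + 1) = 1` on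
`GF(4)*`. Vanishing on `T` therefore means `Tr c = 0` and `Tr a = Tr (b t)` for the three nonzero
`t`; these sum to zero, so `Tr a = 0` and `b` lies in the trace dual of `T`. The word of `(a, b)`
has weight `(q - S(a, b)) / 2`, where `S` is `goldSum`.

Put `h = 2 ^ (m / 2)`. Squaring `S` reduces it to a character sum over the radical of the quadratic
form: `{0}` if `a⁻¹` is not a `(2 ^ e + 1)`-st power, and otherwise a line `v · GF(4)`. Hence `S` is
`±h` in the first case and `0` or `±2h` in the second, for `a ≠ 0`. For fixed `a`, the size of the
dual and the moments of `S(a, ·)` over it determine how often each value occurs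
(`goldCount_of_not_exists`, `goldCount_of_exists`); the second moment singles out `a = 1`, whose
radical is `T`.

It remains to count the trace-zero `a` of power type. That number is read off from `S(1, 0)`, whose
value among `0, ±2h` is fixed modulo 3 (`card_goldPowers`). Summing over `a` gives
`goldTotal_values`. The value `q` is taken only at `(0, 0)`, so parameters and words correspond
bijectively. -/

/-! ### The trace character and its orthogonality relation. -/

section TraceSign

variable {F : Type*} [Field F] [Algebra (ZMod 2) F]

/-- The additive character `x ↦ (-1) ^ Tr x` of a field of characteristic two. -/
noncomputable def traceSign (F : Type*) [Field F] [Algebra (ZMod 2) F] : AddChar F ℤ where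
  toFun x := if Algebra.trace (ZMod 2) F x = 0 then 1 else -1
  map_zero_eq_one' := by simp
  map_add_eq_mul' x y := by
    rw [map_add]
    generalize Algebra.trace (ZMod 2) F x = s
    generalize Algebra.trace (ZMod 2) F y = t
    revert s t
    decide

theorem traceSign_apply (x : F) :
    traceSign F x = if Algebra.trace (ZMod 2) F x = 0 then 1 else -1 := rfl

theorem traceSign_eq_one_iff (x : F) :
    traceSign F x = 1 ↔ Algebra.trace (ZMod 2) F x = 0 := by
  rw [traceSign_apply]
  split_ifs with h <;> simp [h]

theorem traceSign_eq_or (x : F) : traceSign F x = 1 ∨ traceSign F x = -1 := by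
  rw [traceSign_apply]
  split_ifs <;> simp

variable [Fintype F]

theorem traceSign_isPrimitive : (traceSign F).IsPrimitive := by
  intro a ha h
  refine ha ((traceForm_nondegenerate (ZMod 2) F).1 a fun y => ?_)
  have h' := DFunLike.congr_fun h y
  rw [AddChar.mulShift_apply, AddChar.one_apply, traceSign_eq_one_iff] at h'
  rwa [Algebra.traceForm_apply]

theorem sum_traceSign_mul [DecidableEq F] (b : F) :
    ∑ x : F, traceSign F (x * b) = if b = 0 then (Fintype.card F : ℤ) else 0 := by
  rw [AddChar.sum_mulShift b traceSign_isPrimitive]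
  push_cast
  rfl

theorem traceSign_sq (x : F) : traceSign F (x ^ 2) = traceSign F x := by
  have h := Algebra.trace_eq_of_algEquiv (FiniteField.frobeniusAlgEquivOfAlgebraic (ZMod 2) F) x
  rw [FiniteField.coe_frobeniusAlgEquivOfAlgebraic] at h
  rw [traceSign_apply, traceSign_apply, ← h]
  simp

end TraceSign

/-! ### Squaring the exponential sum. -/

section GoldSum

variable {F : Type*} [Field F] [Fintype F] [Algebra (ZMod 2) F]

theorem traceSign_pow_two_pow (x : F) (k : ℕ) : traceSign F (x ^ 2 ^ k) = traceSign F x := by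
  induction k with
  | zero => simp
  | succ k ih => rw [pow_succ, pow_mul, traceSign_sq, ih]

/-- The exponential sum `∑ₓ (-1) ^ Tr (a x ^ (2 ^ e + 1) + b x)`. -/
noncomputable def goldSum (e : ℕ) (a b : F) : ℤ :=
  ∑ x : F, traceSign F (a * x ^ (2 ^ e + 1) + b * x)

/-- The radical of the quadratic form `Tr (a x ^ (2 ^ e + 1))`. -/
def goldRadical {F : Type*} [Field F] [Fintype F] [DecidableEq F] (e : ℕ) (a : F) : Finset F :=
  {u | a * u + a ^ 2 ^ e * u ^ 2 ^ (2 * e) = 0}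

variable [DecidableEq F]

/-- Frobenius invariance of the trace turns both terms into multiples of `x ^ 2 ^ e`, which runs
over all of `F`, so orthogonality applies. -/
theorem sum_traceSign_polar [CharP F 2] (e : ℕ) (a u : F) :
    ∑ x : F, traceSign F (a * (x ^ 2 ^ e * u + x * u ^ 2 ^ e)) =
      if u ∈ goldRadical e a then (Fintype.card F : ℤ) else 0 := by
  have h : ∀ x : F, traceSign F (a * (x ^ 2 ^ e * u + x * u ^ 2 ^ e)) =
      traceSign F (x ^ 2 ^ e * (a * u + a ^ 2 ^ e * u ^ 2 ^ (2 * e))) := by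
    intro x
    have h2 : (a * (x * u ^ 2 ^ e)) ^ 2 ^ e = x ^ 2 ^ e * (a ^ 2 ^ e * u ^ 2 ^ (2 * e)) := by
      rw [mul_pow, mul_pow, ← pow_mul, ← pow_add, two_mul]
      ring
    rw [mul_add, AddChar.map_add_eq_mul, ← traceSign_pow_two_pow (a * (x * u ^ 2 ^ e)) e, h2,
      ← AddChar.map_add_eq_mul]
    congr 1
    ring
  have hbij : Function.Bijective fun x : F => x ^ 2 ^ e := by
    have := (iterateFrobenius F 2 e).injective
    exact (Finite.injective_iff_bijective).1 this
  simp_rw [h]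
  rw [hbij.sum_comp (fun y => traceSign F (y * (a * u + a ^ 2 ^ e * u ^ 2 ^ (2 * e)))),
    sum_traceSign_mul]
  simp [goldRadical]

theorem goldSum_sq [CharP F 2] (e : ℕ) (a b : F) :
    goldSum e a b ^ 2 = Fintype.card F *
      ∑ u ∈ goldRadical e a, traceSign F (a * u ^ (2 ^ e + 1) + b * u) := by
  have key : ∀ x u : F,
      (a * x ^ (2 ^ e + 1) + b * x) + (a * (x + u) ^ (2 ^ e + 1) + b * (x + u)) =
        (a * u ^ (2 ^ e + 1) + b * u) + a * (x ^ 2 ^ e * u + x * u ^ 2 ^ e) := by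
    intro x u
    rw [pow_succ (x + u), add_pow_char_pow]
    linear_combination (a * x ^ (2 ^ e + 1) + b * x) * CharTwo.two_eq_zero (R := F)
  calc goldSum e a b ^ 2
      = ∑ x : F, ∑ u : F, traceSign F
          ((a * u ^ (2 ^ e + 1) + b * u) + a * (x ^ 2 ^ e * u + x * u ^ 2 ^ e)) := by
        rw [sq, goldSum, Finset.sum_mul]
        refine Finset.sum_congr rfl fun x _ => ?_
        -- Writing the second variable as `x + u` leaves only the polar form depending on `x`.
        rw [← Equiv.sum_comp (Equiv.addLeft x), Finset.mul_sum]
        refine Finset.sum_congr rfl fun u _ => ?_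
        rw [← AddChar.map_add_eq_mul, Equiv.coe_addLeft, key]
    _ = ∑ u : F, traceSign F (a * u ^ (2 ^ e + 1) + b * u) *
          if u ∈ goldRadical e a then (Fintype.card F : ℤ) else 0 := by
        rw [Finset.sum_comm]
        refine Finset.sum_congr rfl fun u _ => ?_
        simp_rw [AddChar.map_add_eq_mul _ (a * u ^ (2 ^ e + 1) + b * u)]
        rw [← Finset.mul_sum, sum_traceSign_polar]
    _ = _ := by
        simp_rw [mul_ite, mul_zero]
        rw [← Finset.sum_filter, Finset.mul_sum]
        simp only [Finset.filter_univ_mem, mul_comm]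

theorem goldSum_zero_left (e : ℕ) (b : F) :
    goldSum e 0 b = if b = 0 then (Fintype.card F : ℤ) else 0 := by
  rw [← sum_traceSign_mul, goldSum]
  refine Finset.sum_congr rfl fun x _ => ?_
  rw [zero_mul, zero_add, mul_comm]

end GoldSum

/-! ### Fixed points of Frobenius powers and roots of unity of order dividing `2 ^ e + 1`. -/

section Field

variable {F : Type*} [Field F]

/-- Periods of a point under squaring are closed under gcd. -/
theorem pow_two_pow_gcd_eq_self {x : F} {i j : ℕ} (hi : x ^ 2 ^ i = x) (hj : x ^ 2 ^ j = x) :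
    x ^ 2 ^ Nat.gcd i j = x := by
  have hp : ∀ n, Function.IsPeriodicPt (fun y : F => y ^ 2) n x ↔ x ^ 2 ^ n = x := by
    intro n
    rw [Function.IsPeriodicPt, pow_iterate]
    rfl
  exact (hp _).1 (((hp i).2 hi).gcd ((hp j).2 hj))

theorem pow_gold_eq_one_of_pow_four_eq_self {e : ℕ} (he : Odd e) {z : F} (hz : z ≠ 0)
    (h : z ^ 4 = z) : z ^ (2 ^ e + 1) = 1 := by
  have h3 : z ^ 3 = 1 := mul_right_cancel₀ hz (by rw [one_mul, ← pow_succ, h])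
  have hd : 3 ∣ 2 ^ e + 1 := by simpa using he.nat_add_dvd_pow_add_pow 2 1
  obtain ⟨k, hk⟩ := hd
  rw [hk, pow_mul, h3, one_pow]

variable [Fintype F]

theorem eq_one_of_pow_two_pow_eq_self {m e : ℕ} (hF : Fintype.card F = 2 ^ m)
    (hme : Nat.gcd m e = 1) {z : F} (hz : z ≠ 0) (h : z ^ 2 ^ e = z) : z = 1 := by
  have h1 := pow_two_pow_gcd_eq_self (hF ▸ FiniteField.pow_card z : z ^ 2 ^ m = z) h
  rw [hme, pow_one, sq] at h1
  exact mul_left_cancel₀ hz (by rw [h1, mul_one])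

/-- Here `z ^ 2 ^ e = z⁻¹`, so `z` is fixed by Frobenius to the power `2 * e`, and `gcd(m, 2e) = 2`.
-/
theorem pow_four_eq_self_of_pow_gold_eq_one {m e : ℕ} (hF : Fintype.card F = 2 ^ m)
    (hm : Even m) (hme : Nat.gcd m e = 1) {z : F} (h : z ^ (2 ^ e + 1) = 1) : z ^ 4 = z := by
  have hz : z ≠ 0 := by rintro rfl; simp at h
  have h2 : z ^ 2 ^ (2 * e) = z := by
    apply mul_right_cancel₀ (pow_ne_zero (2 ^ e) hz)
    rw [← pow_succ', h, two_mul, pow_add 2, pow_mul, ← mul_pow, ← pow_succ, h, one_pow]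
  have h1 := pow_two_pow_gcd_eq_self (hF ▸ FiniteField.pow_card z : z ^ 2 ^ m = z) h2
  have hg : Nat.gcd m (2 * e) = 2 := by
    rw [Nat.Coprime.gcd_mul_right_cancel_right 2 (show Nat.Coprime e m by rwa [Nat.coprime_comm])]
    exact Nat.gcd_eq_right hm.two_dvd
  rw [hg] at h1
  exact h1

end Field

/-! ### The radical of the quadratic form. -/

section Radical

variable {F : Type*} [Field F] [Fintype F] [DecidableEq F]

theorem zero_mem_goldRadical (e : ℕ) (a : F) : 0 ∈ goldRadical e a := by
  simp [goldRadical]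

/-- Multiplied by `u ^ 2 ^ e`, the radical equation reads `y + y ^ 2 ^ e = 0` for `y = a * u ^ (2 ^
e + 1)`; a nonzero such `y` lies in `GF(2)`. -/
theorem mem_goldRadical_iff [CharP F 2] {m e : ℕ} (hF : Fintype.card F = 2 ^ m)
    (hme : Nat.gcd m e = 1) {a u : F} (ha : a ≠ 0) (hu : u ≠ 0) :
    u ∈ goldRadical e a ↔ a * u ^ (2 ^ e + 1) = 1 := by
  have key : u ^ 2 ^ e * (a * u + a ^ 2 ^ e * u ^ 2 ^ (2 * e)) =
      a * u ^ (2 ^ e + 1) + (a * u ^ (2 ^ e + 1)) ^ 2 ^ e := by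
    rw [mul_pow, ← pow_mul, add_mul, ← pow_add, ← two_mul, one_mul, pow_add u (2 ^ (2 * e))]
    ring
  have h1 : u ∈ goldRadical e a ↔ u ^ 2 ^ e * (a * u + a ^ 2 ^ e * u ^ 2 ^ (2 * e)) = 0 := by
    simp [goldRadical, hu]
  rw [h1, key, CharTwo.add_eq_zero]
  constructor
  · intro h
    exact eq_one_of_pow_two_pow_eq_self hF hme
      (mul_ne_zero ha (pow_ne_zero _ hu)) h.symm
  · intro h
    rw [h, one_pow]

theorem goldRadical_eq_singleton [CharP F 2] {m e : ℕ} (hF : Fintype.card F = 2 ^ m)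
    (hme : Nat.gcd m e = 1) {a : F} (ha : a ≠ 0) (h : ¬ ∃ u, a * u ^ (2 ^ e + 1) = 1) :
    goldRadical e a = {0} := by
  ext u
  rw [Finset.mem_singleton]
  constructor
  · intro hu
    by_contra hu0
    exact h ⟨u, (mem_goldRadical_iff hF hme ha hu0).1 hu⟩
  · rintro rfl
    exact zero_mem_goldRadical e a

theorem mem_goldRadical_iff_pow_four [CharP F 2] {m e : ℕ} (hF : Fintype.card F = 2 ^ m)
    (hm : Even m) (he : Odd e) (hme : Nat.gcd m e = 1) {a v : F}
    (hv : a * v ^ (2 ^ e + 1) = 1) (t : F) : v * t ∈ goldRadical e a ↔ t ^ 4 = t := by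
  have ha : a ≠ 0 := left_ne_zero_of_mul_eq_one hv
  have hv0 : v ≠ 0 := by rintro rfl; simp at hv
  rcases eq_or_ne t 0 with rfl | ht
  · simp [zero_mem_goldRadical]
  · rw [mem_goldRadical_iff hF hme ha (mul_ne_zero hv0 ht), mul_pow, ← mul_assoc, hv, one_mul]
    exact ⟨pow_four_eq_self_of_pow_gold_eq_one hF hm hme,
      pow_gold_eq_one_of_pow_four_eq_self he ht⟩

theorem inter_goldRadical_one [CharP F 2] {T : Finset F} (hT : ∀ x, x ∈ T ↔ x ^ 4 = x)
    {m e : ℕ} (hF : Fintype.card F = 2 ^ m) (hm : Even m) (he : Odd e)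
    (hme : Nat.gcd m e = 1) : T ∩ goldRadical e (1 : F) = T := by
  refine Finset.inter_eq_left.2 fun t ht => ?_
  have := mem_goldRadical_iff_pow_four hF hm he hme (a := (1 : F)) (v := 1) (by simp) t
  rw [one_mul] at this
  exact this.2 ((hT t).1 ht)

theorem inter_goldRadical_of_ne_one [CharP F 2] {T : Finset F} (hT : ∀ x, x ∈ T ↔ x ^ 4 = x)
    {m e : ℕ} (hF : Fintype.card F = 2 ^ m) (he : Odd e) (hme : Nat.gcd m e = 1) {a : F}
    (ha : a ≠ 0) (ha1 : a ≠ 1) : T ∩ goldRadical e a = {0} := by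
  ext t
  rw [Finset.mem_inter, Finset.mem_singleton]
  constructor
  · rintro ⟨h1, h2⟩
    by_contra h0
    rw [mem_goldRadical_iff hF hme ha h0,
      pow_gold_eq_one_of_pow_four_eq_self he h0 ((hT t).1 h1), mul_one] at h2
    exact ha1 h2
  · rintro rfl
    exact ⟨(hT 0).2 (by simp), zero_mem_goldRadical e a⟩

end Radical

/-! ### Moments of the exponential sum over the trace dual of `GF(4)`. -/

section Moments

variable {F : Type*} [Field F] [Algebra (ZMod 2) F]

theorem traceSign_mul_pow_gold {T : Finset F} (hT : ∀ x, x ∈ T ↔ x ^ 4 = x) {e : ℕ}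
    (he : Odd e) {a t : F} (ha : traceSign F a = 1) (ht : t ∈ T) :
    traceSign F (a * t ^ (2 ^ e + 1)) = 1 := by
  rcases eq_or_ne t 0 with rfl | h0
  · simp
  · rw [pow_gold_eq_one_of_pow_four_eq_self he h0 ((hT t).1 ht), mul_one, ha]

variable [Fintype F]

theorem traceSign_one {m : ℕ} (hF : Fintype.card F = 2 ^ m) (hm : Even m) :
    traceSign F 1 = 1 := by
  have h : Module.finrank (ZMod 2) F = m := by
    have := Module.card_eq_pow_finrank (K := ZMod 2) (V := F)
    rw [hF, ZMod.card] at this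
    exact (Nat.pow_right_injective le_rfl this).symm
  rw [traceSign_eq_one_iff, ← map_one (algebraMap (ZMod 2) F), Algebra.trace_algebraMap, h,
    nsmul_eq_mul, mul_one]
  exact (ZMod.natCast_eq_zero_iff m 2).2 hm.two_dvd

variable [DecidableEq F]

/-- The elements `b` with `Tr (b t) = 0` for all `t ∈ T`. -/
noncomputable def traceDual (T : Finset F) : Finset F := {b | ∀ t ∈ T, traceSign F (b * t) = 1}

theorem mem_traceDual {T : Finset F} {b : F} :
    b ∈ traceDual T ↔ ∀ t ∈ T, traceSign F (b * t) = 1 := by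
  simp [traceDual]

/-- If the character is `-1` at some `s ∈ T`, translation by `s` permutes `T` and negates the sum.
-/
theorem sum_traceSign_mul_mem [CharP F 2] {T : Finset F} (hT : ∀ x, x ∈ T ↔ x ^ 4 = x) (b : F) :
    ∑ t ∈ T, traceSign F (b * t) = if b ∈ traceDual T then (T.card : ℤ) else 0 := by
  split_ifs with h
  · rw [Finset.sum_congr rfl (mem_traceDual.1 h)]
    simp
  · rw [mem_traceDual] at h
    push Not at h
    obtain ⟨s, hs, hs'⟩ := h
    have hs1 := (traceSign_eq_or (b * s)).resolve_left hs'
    have hadd : ∀ t, t ∈ T ↔ Equiv.addRight s t ∈ T := by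
      intro t
      have h4 : (t + s) ^ 4 = t ^ 4 + s ^ 4 := add_pow_char_pow (p := 2) (n := 2) t s
      rw [Equiv.coe_addRight, hT, hT, h4, (hT s).1 hs, add_left_inj]
    have h1 : ∑ t ∈ T, traceSign F (b * t) = ∑ t ∈ T, -traceSign F (b * t) := by
      symm
      refine Finset.sum_equiv (Equiv.addRight s) hadd fun t _ => ?_
      rw [Equiv.coe_addRight, mul_add, AddChar.map_add_eq_mul, hs1, mul_neg_one]
    rw [Finset.sum_neg_distrib] at h1
    linarith

/-- Poisson summation: it converts moments over the dual into full sums over `b`, where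
orthogonality applies. -/
theorem card_mul_sum_traceDual [CharP F 2] {T : Finset F} (hT : ∀ x, x ∈ T ↔ x ^ 4 = x)
    (g : F → ℤ) :
    (T.card : ℤ) * ∑ b ∈ traceDual T, g b = ∑ t ∈ T, ∑ b : F, traceSign F (b * t) * g b := by
  rw [Finset.sum_comm]
  simp_rw [← Finset.sum_mul, sum_traceSign_mul_mem hT, ite_mul, zero_mul]
  rw [← Finset.sum_filter, Finset.mul_sum]
  simp only [Finset.filter_univ_mem]

theorem card_mul_card_traceDual [CharP F 2] {T : Finset F} (hT : ∀ x, x ∈ T ↔ x ^ 4 = x) :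
    T.card * (traceDual T).card = Fintype.card F := by
  have h := card_mul_sum_traceDual hT (fun _ => 1)
  have h0 : (0 : F) ∈ T := (hT 0).2 (by simp)
  simp_rw [mul_one, sum_traceSign_mul] at h
  rw [Finset.sum_ite_eq' T 0, if_pos h0] at h
  simp only [Finset.sum_const, nsmul_eq_mul, mul_one] at h
  exact_mod_cast h

/-- First moment: for each `t ∈ T`, summing over `b` leaves only `x = t`, where the quadratic term
has trace zero. -/
theorem sum_traceDual_goldSum [CharP F 2] {T : Finset F} (hT : ∀ x, x ∈ T ↔ x ^ 4 = x)
    (hTc : T.card = 4) {e : ℕ} (he : Odd e) {a : F} (ha : traceSign F a = 1) :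
    ∑ b ∈ traceDual T, goldSum e a b = Fintype.card F := by
  have h := card_mul_sum_traceDual hT (goldSum e a)
  have h1 : ∀ t ∈ T, ∑ b : F, traceSign F (b * t) * goldSum e a b = Fintype.card F := by
    intro t ht
    simp_rw [goldSum, Finset.mul_sum]
    rw [Finset.sum_comm]
    have h2 : ∀ x : F, ∑ b : F, traceSign F (b * t) * traceSign F (a * x ^ (2 ^ e + 1) + b * x) =
        if x = t then (Fintype.card F : ℤ) * traceSign F (a * x ^ (2 ^ e + 1)) else 0 := by
      intro x
      have h3 : ∀ b : F, traceSign F (b * t) * traceSign F (a * x ^ (2 ^ e + 1) + b * x) =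
          traceSign F (b * (x + t)) * traceSign F (a * x ^ (2 ^ e + 1)) := by
        intro b
        rw [← AddChar.map_add_eq_mul, ← AddChar.map_add_eq_mul]
        congr 1
        ring
      simp_rw [h3]
      simp only [← Finset.sum_mul, sum_traceSign_mul, CharTwo.add_eq_zero, ite_mul, zero_mul]
    simp_rw [h2]
    rw [Finset.sum_ite_eq' Finset.univ t, if_pos (Finset.mem_univ t),
      traceSign_mul_pow_gold hT he ha ht, mul_one]
  rw [Finset.sum_congr rfl h1, Finset.sum_const, hTc] at h
  simp only [nsmul_eq_mul] at h
  push_cast at h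
  linarith

/-- On nonzero radical elements the quadratic term equals `1`, and `Tr 1 = m = 0` in `GF(2)`. -/
theorem goldSum_sq_eq_sum_goldRadical [CharP F 2] {m e : ℕ} (hF : Fintype.card F = 2 ^ m)
    (hm : Even m) (hme : Nat.gcd m e = 1) {a : F} (ha : a ≠ 0) (b : F) :
    goldSum e a b ^ 2 = Fintype.card F * ∑ u ∈ goldRadical e a, traceSign F (b * u) := by
  rw [goldSum_sq]
  congr 1
  refine Finset.sum_congr rfl fun u hu => ?_
  rw [AddChar.map_add_eq_mul]
  rcases eq_or_ne u 0 with rfl | h0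
  · simp
  · rw [(mem_goldRadical_iff hF hme ha h0).1 hu, traceSign_one hF hm, one_mul]

theorem sum_traceDual_goldSum_sq [CharP F 2] {T : Finset F} (hT : ∀ x, x ∈ T ↔ x ^ 4 = x)
    {m e : ℕ} (hF : Fintype.card F = 2 ^ m)
    (hm : Even m) (hme : Nat.gcd m e = 1) {a : F} (ha : a ≠ 0) :
    (T.card : ℤ) * ∑ b ∈ traceDual T, goldSum e a b ^ 2 =
      (Fintype.card F : ℤ) ^ 2 * (T ∩ goldRadical e a).card := by
  rw [card_mul_sum_traceDual hT (fun b => goldSum e a b ^ 2)]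
  have h1 : ∀ t : F, ∑ b : F, traceSign F (b * t) * goldSum e a b ^ 2 =
      if t ∈ goldRadical e a then (Fintype.card F : ℤ) ^ 2 else 0 := by
    intro t
    simp_rw [goldSum_sq_eq_sum_goldRadical hF hm hme ha, Finset.mul_sum]
    rw [Finset.sum_comm]
    have h2 : ∀ u : F, ∑ b : F, traceSign F (b * t) *
        ((Fintype.card F : ℤ) * traceSign F (b * u)) =
        if u = t then (Fintype.card F : ℤ) ^ 2 else 0 := by
      intro u
      have h3 : ∀ b : F, traceSign F (b * t) * ((Fintype.card F : ℤ) * traceSign F (b * u)) =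
          Fintype.card F * traceSign F (b * (u + t)) := by
        intro b
        rw [mul_add b, AddChar.map_add_eq_mul]
        ring
      simp_rw [h3]
      simp only [← Finset.mul_sum, sum_traceSign_mul, CharTwo.add_eq_zero, mul_ite, mul_zero, sq]
    simp_rw [h2]
    rw [Finset.sum_ite_eq']
  simp_rw [h1]
  rw [← Finset.sum_filter, Finset.filter_mem_eq_inter]
  simp [mul_comm]

theorem goldSum_sq_of_not_exists [CharP F 2] {m e : ℕ} (hF : Fintype.card F = 2 ^ m)
    (hm : Even m) (hme : Nat.gcd m e = 1) {a : F} (ha : a ≠ 0)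
    (h : ¬ ∃ u, a * u ^ (2 ^ e + 1) = 1) (b : F) :
    goldSum e a b ^ 2 = Fintype.card F := by
  rw [goldSum_sq_eq_sum_goldRadical hF hm hme ha, goldRadical_eq_singleton hF hme ha h]
  simp

/-- The radical is `v · GF(4)`, so the sum over it is the sum over `T` of the character attached to
`b * v`. -/
theorem goldSum_sq_of_exists [CharP F 2] {T : Finset F} (hT : ∀ x, x ∈ T ↔ x ^ 4 = x)
    {m e : ℕ} (hF : Fintype.card F = 2 ^ m) (hm : Even m) (he : Odd e) (hme : Nat.gcd m e = 1)
    {a v : F} (hv : a * v ^ (2 ^ e + 1) = 1) (b : F) :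
    goldSum e a b ^ 2 =
      Fintype.card F * if b * v ∈ traceDual T then (T.card : ℤ) else 0 := by
  have ha : a ≠ 0 := left_ne_zero_of_mul_eq_one hv
  have hv0 : v ≠ 0 := by rintro rfl; simp at hv
  rw [goldSum_sq_eq_sum_goldRadical hF hm hme ha, ← sum_traceSign_mul_mem hT]
  congr 1
  symm
  refine Finset.sum_equiv (Equiv.mulLeft₀ v hv0) (fun t => ?_) fun t _ => ?_
  · rw [Equiv.mulLeft₀_apply, mem_goldRadical_iff_pow_four hF hm he hme hv, hT]
  · rw [Equiv.mulLeft₀_apply, mul_assoc]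

end Moments

/-! ### Value distribution of the sum for a fixed `a`. -/

section Counting

theorem sum_of_three_values {ι : Type*} (B : Finset ι) (g : ι → ℤ) {c : ℤ} (hc : 0 < c)
    (hg : ∀ b ∈ B, g b = 0 ∨ g b = c ∨ g b = -c) :
    ∑ b ∈ B, g b = c * ((B.filter (g · = c)).card - (B.filter (g · = -c)).card : ℤ) ∧
    ∑ b ∈ B, g b ^ 2 = c ^ 2 * ((B.filter (g · = c)).card + (B.filter (g · = -c)).card : ℤ) ∧
    (B.card : ℤ) = (B.filter (g · = 0)).card + (B.filter (g · = c)).card +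
      (B.filter (g · = -c)).card := by
  have h1 : c ≠ 0 := hc.ne'
  have h2 : c ≠ -c := by lia
  have h3 : -c ≠ c := by lia
  have h4 : (0 : ℤ) ≠ c := hc.ne
  have h5 : (0 : ℤ) ≠ -c := by lia
  refine ⟨?_, ?_, ?_⟩
  · rw [Finset.natCast_card_filter, Finset.natCast_card_filter, ← Finset.sum_sub_distrib,
      Finset.mul_sum]
    refine Finset.sum_congr rfl fun b hb => ?_
    rcases hg b hb with h | h | h <;> simp [h, h2, h3, h4, h5]
  · rw [Finset.natCast_card_filter, Finset.natCast_card_filter, ← Finset.sum_add_distrib,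
      Finset.mul_sum]
    refine Finset.sum_congr rfl fun b hb => ?_
    rcases hg b hb with h | h | h <;> simp [h, h2, h3, h4, h5]
  · rw [Finset.natCast_card_filter, Finset.natCast_card_filter, Finset.natCast_card_filter,
      ← Finset.sum_add_distrib, ← Finset.sum_add_distrib, Finset.cast_card]
    refine Finset.sum_congr rfl fun b hb => ?_
    rcases hg b hb with h | h | h <;> simp [h, h1, h2, h3, h4, h5]

variable {F : Type*} [Field F] [Fintype F] [DecidableEq F] [Algebra (ZMod 2) F]

/-- The number of `b` in the trace dual of `T` with `goldSum e a b = s`. -/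
noncomputable def goldCount (T : Finset F) (e : ℕ) (a : F) (s : ℤ) : ℕ :=
  ((traceDual T).filter (goldSum e a · = s)).card

theorem goldCount_eq_zero {T : Finset F} {e : ℕ} {a : F} {s : ℤ}
    (h : ∀ b, goldSum e a b ≠ s) : goldCount T e a s = 0 := by
  rw [goldCount, Finset.card_eq_zero, Finset.filter_eq_empty_iff]
  exact fun b _ => h b

theorem zero_mem_traceDual (T : Finset F) : 0 ∈ traceDual T := by
  simp [mem_traceDual]

theorem goldCount_zero_left_card {T : Finset F} {e : ℕ} :
    goldCount T e (0 : F) (Fintype.card F) = 1 := by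
  rw [goldCount, Finset.card_eq_one]
  refine ⟨0, ?_⟩
  ext b
  rw [Finset.mem_filter, goldSum_zero_left, Finset.mem_singleton]
  constructor
  · rintro ⟨-, h⟩
    by_contra hb
    rw [if_neg hb] at h
    exact Fintype.card_ne_zero (by exact_mod_cast h.symm)
  · rintro rfl
    simp [zero_mem_traceDual]

theorem goldCount_zero_left_zero {T : Finset F} {e : ℕ} :
    goldCount T e (0 : F) 0 + 1 = (traceDual T).card := by
  rw [goldCount, ← Finset.card_erase_add_one (zero_mem_traceDual T)]
  congr 2
  ext b
  rw [Finset.mem_filter, goldSum_zero_left, Finset.mem_erase, and_comm]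
  simp

theorem goldSum_eq_of_not_exists [CharP F 2] {m e : ℕ} (hF : Fintype.card F = 2 ^ m)
    (hm : Even m) (hme : Nat.gcd m e = 1) {h : ℤ} (hh : (Fintype.card F : ℤ) = h ^ 2) {a : F}
    (ha : a ≠ 0) (hn : ¬ ∃ u, a * u ^ (2 ^ e + 1) = 1) (b : F) :
    goldSum e a b = h ∨ goldSum e a b = -h := by
  rw [← sq_eq_sq_iff_eq_or_eq_neg, ← hh]
  exact goldSum_sq_of_not_exists hF hm hme ha hn b

theorem goldSum_eq_of_exists [CharP F 2] {T : Finset F} (hT : ∀ x, x ∈ T ↔ x ^ 4 = x)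
    (hTc : T.card = 4) {m e : ℕ} (hF : Fintype.card F = 2 ^ m)
    (hm : Even m) (he : Odd e) (hme : Nat.gcd m e = 1) {h : ℤ}
    (hh : (Fintype.card F : ℤ) = h ^ 2) {a : F}
    (hn : ∃ u, a * u ^ (2 ^ e + 1) = 1) (b : F) :
    goldSum e a b = 0 ∨ goldSum e a b = 2 * h ∨ goldSum e a b = -(2 * h) := by
  obtain ⟨v, hv⟩ := hn
  have h2 := goldSum_sq_of_exists hT hF hm he hme hv b
  rw [hTc, hh] at h2
  split_ifs at h2
  · right
    rw [← sq_eq_sq_iff_eq_or_eq_neg, h2]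
    push_cast
    ring
  · left
    simpa using h2

theorem goldCount_of_not_exists [CharP F 2] {T : Finset F} (hT : ∀ x, x ∈ T ↔ x ^ 4 = x)
    (hTc : T.card = 4) {m e : ℕ} (hF : Fintype.card F = 2 ^ m)
    (hm : Even m) (he : Odd e) (hme : Nat.gcd m e = 1) {h : ℤ} (hpos : 0 < h)
    (hh : (Fintype.card F : ℤ) = h ^ 2) {a : F} (ha : a ≠ 0) (hta : traceSign F a = 1)
    (hn : ¬ ∃ u, a * u ^ (2 ^ e + 1) = 1) :
    8 * (goldCount T e a h : ℤ) = h ^ 2 + 4 * h ∧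
      8 * (goldCount T e a (-h) : ℤ) = h ^ 2 - 4 * h := by
  have hv := goldSum_eq_of_not_exists hF hm hme hh ha hn
  obtain ⟨h1, -, h3⟩ := sum_of_three_values (traceDual T) (goldSum e a) hpos
    fun b _ => Or.inr (hv b)
  -- The three-value lemma also allows the value `0`, which does not occur here.
  have h0 : goldCount T e a 0 = 0 := goldCount_eq_zero fun b => by
    rcases hv b with h | h <;> lia
  have h4 := card_mul_card_traceDual hT
  rw [sum_traceDual_goldSum hT hTc he hta, hh, sq] at h1
  have h5 := mul_left_cancel₀ hpos.ne' h1
  rw [hTc] at h4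
  have h6 : 4 * ((traceDual T).card : ℤ) = h ^ 2 := by rw [← hh, ← h4]; push_cast; ring
  unfold goldCount at *
  lia

theorem goldCount_of_exists [CharP F 2] {T : Finset F} (hT : ∀ x, x ∈ T ↔ x ^ 4 = x)
    (hTc : T.card = 4) {m e : ℕ} (hF : Fintype.card F = 2 ^ m)
    (hm : Even m) (he : Odd e) (hme : Nat.gcd m e = 1) {h : ℤ} (hpos : 0 < h)
    (hh : (Fintype.card F : ℤ) = h ^ 2) {a : F} (hta : traceSign F a = 1)
    (hn : ∃ u, a * u ^ (2 ^ e + 1) = 1) :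
    2 * (goldCount T e a (2 * h) - goldCount T e a (-(2 * h)) : ℤ) = h ∧
    16 * (goldCount T e a (2 * h) + goldCount T e a (-(2 * h)) : ℤ) =
      h ^ 2 * (T ∩ goldRadical e a).card ∧
    4 * (goldCount T e a 0 + goldCount T e a (2 * h) + goldCount T e a (-(2 * h)) : ℤ) =
      h ^ 2 := by
  have ha : a ≠ 0 := by rintro rfl; simp at hn
  obtain ⟨h1, h2, h3⟩ := sum_of_three_values (traceDual T) (goldSum e a) (c := 2 * h) (by lia)
    fun b _ => goldSum_eq_of_exists hT hTc hF hm he hme hh hn b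
  have h4 := card_mul_card_traceDual hT
  have h7 := sum_traceDual_goldSum_sq hT hF hm hme ha
  rw [h2, hh, hTc] at h7
  rw [sum_traceDual_goldSum hT hTc he hta, hh] at h1
  rw [hTc] at h4
  unfold goldCount
  refine ⟨?_, ?_, ?_⟩
  · apply mul_left_cancel₀ hpos.ne'
    linear_combination -h1
  · apply mul_left_cancel₀ (pow_ne_zero 2 hpos.ne')
    push_cast at h7
    linear_combination h7
  · rw [← h3, ← hh, ← h4]
    push_cast
    ring

theorem goldCount_one [CharP F 2] {T : Finset F} (hT : ∀ x, x ∈ T ↔ x ^ 4 = x)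
    (hTc : T.card = 4) {m e : ℕ} (hF : Fintype.card F = 2 ^ m)
    (hm : Even m) (he : Odd e) (hme : Nat.gcd m e = 1) {h : ℤ} (hpos : 0 < h)
    (hh : (Fintype.card F : ℤ) = h ^ 2) :
    8 * (goldCount T e (1 : F) (2 * h) : ℤ) = h ^ 2 + 2 * h ∧
      8 * (goldCount T e (1 : F) (-(2 * h)) : ℤ) = h ^ 2 - 2 * h ∧
      goldCount T e (1 : F) 0 = 0 := by
  have := goldCount_of_exists hT hTc hF hm he hme hpos hh (traceSign_one hF hm) ⟨1, by simp⟩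
  rw [inter_goldRadical_one hT hF hm he hme, hTc] at this
  lia

/-- The radical meets `T` only in `0`, which fixes the second moment. For `h < 8` the second count
would be negative, so no such `a` exists then. -/
theorem goldCount_of_exists_of_ne_one [CharP F 2] {T : Finset F}
    (hT : ∀ x, x ∈ T ↔ x ^ 4 = x)
    (hTc : T.card = 4) {m e : ℕ} (hF : Fintype.card F = 2 ^ m)
    (hm : Even m) (he : Odd e) (hme : Nat.gcd m e = 1) {h : ℤ} (hpos : 0 < h)
    (hh : (Fintype.card F : ℤ) = h ^ 2) {a : F} (ha : a ≠ 1) (hta : traceSign F a = 1)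
    (hn : ∃ u, a * u ^ (2 ^ e + 1) = 1) :
    32 * (goldCount T e a (2 * h) : ℤ) = h ^ 2 + 8 * h ∧
      32 * (goldCount T e a (-(2 * h)) : ℤ) = h ^ 2 - 8 * h ∧
      16 * (goldCount T e a 0 : ℤ) = 3 * h ^ 2 := by
  have ha0 : a ≠ 0 := by rintro rfl; simp at hn
  have := goldCount_of_exists hT hTc hF hm he hme hpos hh hta hn
  rw [inter_goldRadical_of_ne_one hT hF he hme ha0 ha, Finset.card_singleton] at this
  lia

end Counting

/-! ### Counting the `a` of power type and summing over `a`. -/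

section Totals

variable {F : Type*} [Field F] [Fintype F] [Algebra (ZMod 2) F]

theorem sum_traceSign_comp (f : F → F) :
    ∑ x : F, traceSign F (f x) =
      2 * (Finset.univ.filter fun x => traceSign F (f x) = 1).card - Fintype.card F := by
  rw [Finset.natCast_card_filter, ← Finset.card_univ, Finset.cast_card, Finset.mul_sum,
    ← Finset.sum_sub_distrib]
  refine Finset.sum_congr rfl fun x _ => ?_
  rcases traceSign_eq_or (f x) with h | h <;> simp [h]

variable [DecidableEq F]

theorem two_mul_card_traceSign_eq_one :
    2 * ((Finset.univ.filter fun a : F => traceSign F a = 1).card : ℤ) = Fintype.card F := by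
  have h := sum_traceSign_comp fun x : F => x
  have h2 := sum_traceSign_mul (1 : F)
  simp only [mul_one, one_ne_zero, if_false] at h2
  lia

/-- The trace-zero elements that are inverses of `2 ^ e + 1`-st powers. -/
noncomputable def goldPowers (F : Type*) [Field F] [Fintype F] [DecidableEq F]
    [Algebra (ZMod 2) F] (e : ℕ) : Finset F :=
  (Finset.univ.filter fun a : F => traceSign F a = 1).filter fun a =>
    ∃ u, a * u ^ (2 ^ e + 1) = 1

theorem mem_goldPowers {e : ℕ} {a : F} :
    a ∈ goldPowers F e ↔ traceSign F a = 1 ∧ ∃ u, a * u ^ (2 ^ e + 1) = 1 := by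
  simp [goldPowers]

/-- The power map is three-to-one on nonzero elements, its fibres being cosets of `GF(4)*`; the `+
1` is `x = 0`. -/
theorem card_traceSign_pow_gold {T : Finset F} (hT : ∀ x, x ∈ T ↔ x ^ 4 = x)
    (hTc : T.card = 4) {m e : ℕ} (hF : Fintype.card F = 2 ^ m)
    (hm : Even m) (he : Odd e) (hme : Nat.gcd m e = 1) :
    (Finset.univ.filter fun x : F => traceSign F (x ^ (2 ^ e + 1)) = 1).card =
      3 * (goldPowers F e).card + 1 := by
  set X := Finset.univ.filter fun x : F => traceSign F (x ^ (2 ^ e + 1)) = 1 with hX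
  have h0 : (0 : F) ∈ X := by simp [hX]
  have h0T : (0 : F) ∈ T := (hT 0).2 (by simp)
  rw [← Finset.card_erase_add_one h0, add_left_inj]
  have hmaps : ∀ x ∈ X.erase 0, x ^ (2 ^ e + 1) ∈ goldPowers F e := by
    intro x hx
    rw [Finset.mem_erase, hX, Finset.mem_filter] at hx
    exact mem_goldPowers.2 ⟨hx.2.2, x⁻¹, by rw [← mul_pow, mul_inv_cancel₀ hx.1, one_pow]⟩
  rw [Finset.card_eq_sum_card_fiberwise hmaps]
  have hfib : ∀ y ∈ goldPowers F e,
      ((X.erase 0).filter fun x => x ^ (2 ^ e + 1) = y).card = 3 := by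
    intro y hy
    obtain ⟨hy1, u, hu⟩ := mem_goldPowers.1 hy
    have hu0 : u ≠ 0 := by rintro rfl; simp at hu
    have h3 : (T.erase 0).card = 3 := by rw [Finset.card_erase_of_mem h0T, hTc]
    rw [← h3]
    refine Finset.card_equiv (Equiv.mulLeft₀ u hu0) fun x => ?_
    rw [Equiv.mulLeft₀_apply, Finset.mem_filter, Finset.mem_erase, Finset.mem_erase, hT,
      hX, Finset.mem_filter]
    constructor
    · rintro ⟨⟨hx0, -⟩, hxy⟩
      refine ⟨mul_ne_zero hu0 hx0, pow_four_eq_self_of_pow_gold_eq_one hF hm hme ?_⟩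
      rw [mul_pow, hxy, mul_comm, hu]
    · rintro ⟨hux, h4⟩
      have h5 := pow_gold_eq_one_of_pow_four_eq_self he hux h4
      have hxy : x ^ (2 ^ e + 1) = y := by
        apply mul_right_cancel₀ (pow_ne_zero (2 ^ e + 1) hu0)
        rw [hu, ← h5, mul_pow, mul_comm]
      refine ⟨⟨right_ne_zero_of_mul hux, Finset.mem_univ _, ?_⟩, hxy⟩
      rw [hxy, hy1]
  rw [Finset.sum_congr rfl hfib, Finset.sum_const, smul_eq_mul, mul_comm]

theorem card_goldPowers [CharP F 2] {T : Finset F} (hT : ∀ x, x ∈ T ↔ x ^ 4 = x)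
    (hTc : T.card = 4) {k e : ℕ} (hF : Fintype.card F = 2 ^ (2 * k))
    (he : Odd e) (hme : Nat.gcd (2 * k) e = 1) :
    6 * ((goldPowers F e).card : ℤ) =
      ((2 : ℤ) ^ k) ^ 2 - 2 * ((-1) ^ k * (2 : ℤ) ^ k) - 2 := by
  have hm : Even (2 * k) := even_two_mul k
  have hh : (Fintype.card F : ℤ) = ((2 : ℤ) ^ k) ^ 2 := by
    rw [hF, mul_comm, pow_mul]; push_cast; rfl
  have h1 := card_traceSign_pow_gold hT hTc hF hm he hme
  have h2 : goldSum e (1 : F) 0 = 6 * (goldPowers F e).card + 2 - ((2 : ℤ) ^ k) ^ 2 := by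
    have h3 := sum_traceSign_comp fun x : F => x ^ (2 ^ e + 1)
    rw [h1, hh] at h3
    simp only [goldSum, one_mul, zero_mul, add_zero]
    rw [h3]
    push_cast
    ring
  have h3 := goldSum_eq_of_exists hT hTc hF hm he hme hh (a := (1 : F)) ⟨1, by simp⟩ 0
  -- Modulo 3, `S(1, 0) ≡ 2 - q ≡ 1`, which excludes `0`; as `2 ^ k ≡ (-1) ^ k`, the sign is forced:
  -- `S(1, 0) = -2 (-1) ^ k 2 ^ k`.
  have h4 : (3 : ℤ) ∣ 2 ^ k - (-1) ^ k := by
    have := sub_dvd_pow_sub_pow (2 : ℤ) (-1) k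
    norm_num at this
    exact this
  have h5 : (3 : ℤ) ∣ ((2 : ℤ) ^ k) ^ 2 - 1 := by
    have := sub_dvd_pow_sub_pow (4 : ℤ) 1 k
    rw [← pow_mul, mul_comm k 2, pow_mul]
    norm_num at this ⊢
    exact this
  generalize ((2 : ℤ) ^ k) ^ 2 = q at *
  rcases neg_one_pow_eq_or ℤ k with h6 | h6 <;> rw [h6] at h4 ⊢ <;> lia

/-- The exceptional `a` are `1`, of power type, and `0`, which is not; doubling avoids the half in
`q / 2`. -/
theorem sum_traceSign_eq_one_split {m e : ℕ} (hF : Fintype.card F = 2 ^ m)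
    (hm : Even m) (f : F → ℤ) (c d : ℤ)
    (hc : ∀ a, traceSign F a = 1 → a ≠ 1 → (∃ u, a * u ^ (2 ^ e + 1) = 1) → f a = c)
    (hd : ∀ a, traceSign F a = 1 → a ≠ 0 → (¬ ∃ u, a * u ^ (2 ^ e + 1) = 1) → f a = d) :
    2 * ∑ a with traceSign F a = 1, f a = 2 * f 0 + 2 * f 1 +
      2 * ((goldPowers F e).card - 1) * c +
      (Fintype.card F - 2 * (goldPowers F e).card - 2) * d := by
  have h1 : (1 : F) ∈ goldPowers F e := mem_goldPowers.2 ⟨traceSign_one hF hm, 1, by simp⟩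
  rw [← Finset.sum_filter_add_sum_filter_not _ fun a => ∃ u, a * u ^ (2 ^ e + 1) = 1]
  change 2 * (∑ a ∈ goldPowers F e, f a + _) = _
  have hcard := Finset.card_filter_add_card_filter_not
    (s := Finset.univ.filter fun a : F => traceSign F a = 1)
    (fun a => ∃ u, a * u ^ (2 ^ e + 1) = 1)
  change (goldPowers F e).card + _ = _ at hcard
  set N := (Finset.univ.filter fun a : F => traceSign F a = 1).filter
    fun a => ¬ ∃ u, a * u ^ (2 ^ e + 1) = 1 with hN
  have h0 : (0 : F) ∈ N := by simp [hN]
  have hA := two_mul_card_traceSign_eq_one (F := F)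
  have hc' : ∀ a ∈ (goldPowers F e).erase 1, f a = c := fun a ha => by
    rw [Finset.mem_erase, mem_goldPowers] at ha
    exact hc a ha.2.1 ha.1 ha.2.2
  have hd' : ∀ a ∈ N.erase 0, f a = d := fun a ha => by
    rw [Finset.mem_erase, hN, Finset.mem_filter, Finset.mem_filter] at ha
    exact hd a ha.2.1.2 ha.1 ha.2.2
  rw [← Finset.sum_erase_add _ _ h1, ← Finset.sum_erase_add _ _ h0, Finset.sum_congr rfl hc',
    Finset.sum_congr rfl hd', Finset.sum_const, Finset.sum_const, nsmul_eq_mul, nsmul_eq_mul]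
  have e1 := Finset.card_erase_add_one h1
  have e0 := Finset.card_erase_add_one h0
  have e1' : (((goldPowers F e).erase 1).card : ℤ) = (goldPowers F e).card - 1 := by lia
  have e0' : 2 * ((N.erase 0).card : ℤ) =
      Fintype.card F - 2 * (goldPowers F e).card - 2 := by lia
  rw [e1', ← e0']
  ring

/-- The number of pairs `(a, b)` with `Tr a = 0`, `b` in the trace dual of `T` and
`goldSum e a b = s`. -/
noncomputable def goldTotal (T : Finset F) (e : ℕ) (s : ℤ) : ℕ :=
  ∑ a with traceSign F a = 1, goldCount T e a s

theorem goldTotal_values [CharP F 2] {T : Finset F} (hT : ∀ x, x ∈ T ↔ x ^ 4 = x)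
    (hTc : T.card = 4) {k e : ℕ} (hk : 2 ≤ k) (hF : Fintype.card F = 2 ^ (2 * k))
    (he : Odd e) (hme : Nat.gcd (2 * k) e = 1) {h ε : ℤ} (hh : h = 2 ^ k) (hε : ε = (-1) ^ k) :
    goldTotal T e (h ^ 2) = 1 ∧
    192 * (goldTotal T e (2 * h) : ℤ) =
      24 * (h ^ 2 + 2 * h) + (h ^ 2 - 2 * (ε * h) - 8) * (h ^ 2 + 8 * h) ∧
    192 * (goldTotal T e (-(2 * h)) : ℤ) =
      24 * (h ^ 2 - 2 * h) + (h ^ 2 - 2 * (ε * h) - 8) * (h ^ 2 - 8 * h) ∧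
    24 * (goldTotal T e h : ℤ) = (h ^ 2 + ε * h - 2) * (h ^ 2 + 4 * h) ∧
    24 * (goldTotal T e (-h) : ℤ) = (h ^ 2 + ε * h - 2) * (h ^ 2 - 4 * h) ∧
    32 * (goldTotal T e 0 : ℤ) = h ^ 4 - 2 * ε * h ^ 3 - 32 ∧
    ∀ s, s ≠ h ^ 2 → s ≠ 2 * h → s ≠ -(2 * h) → s ≠ h → s ≠ -h → s ≠ 0 →
      goldTotal T e s = 0 := by
  have hm : Even (2 * k) := even_two_mul k
  have hq : (Fintype.card F : ℤ) = h ^ 2 := by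
    rw [hF, hh, mul_comm, pow_mul]; push_cast; rfl
  -- This keeps the six possible values distinct; at `h = 2` one would have `h ^ 2 = 2 * h`.
  have h4 : 4 ≤ h := by
    rw [hh]
    exact le_trans (by norm_num) (pow_le_pow_right₀ (by norm_num : (1 : ℤ) ≤ 2) hk)
  have hpos : 0 < h := by lia
  have hlt : 4 * h ≤ h ^ 2 := by nlinarith
  have hn : 6 * ((goldPowers F e).card : ℤ) = h ^ 2 - 2 * (ε * h) - 2 := by
    rw [hh, hε]
    exact card_goldPowers hT hTc hF he hme
  have v0 : ∀ b : F, goldSum e 0 b = h ^ 2 ∨ goldSum e 0 b = 0 := fun b => by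
    rw [goldSum_zero_left, hq]
    split_ifs <;> simp
  have vc := fun (a : F) => goldSum_eq_of_exists hT hTc hF hm he hme hq (a := a)
  have vn := fun (a : F) => goldSum_eq_of_not_exists hF hm hme hq (a := a)
  have c1 := goldCount_one hT hTc hF hm he hme hpos hq
  have c0 : goldCount T e (0 : F) (h ^ 2) = 1 := hq ▸ goldCount_zero_left_card
  have c00 : 4 * (goldCount T e (0 : F) 0 : ℤ) = h ^ 2 - 4 := by
    have h1 := goldCount_zero_left_zero (T := T) (e := e)
    have h2 := card_mul_card_traceDual hT
    rw [hTc] at h2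
    lia
  have cc := fun (a : F) => goldCount_of_exists_of_ne_one hT hTc hF hm he hme hpos hq (a := a)
  have cn := fun (a : F) => goldCount_of_not_exists hT hTc hF hm he hme hpos hq (a := a)
  have z0 : ∀ s, s ≠ h ^ 2 → s ≠ 0 → goldCount T e (0 : F) s = 0 := fun s h1 h2 =>
    goldCount_eq_zero fun b => by rcases v0 b with h | h <;> rw [h] <;> lia
  have zc : ∀ s, s ≠ 0 → s ≠ 2 * h → s ≠ -(2 * h) → ∀ a : F,
      (∃ u, a * u ^ (2 ^ e + 1) = 1) → goldCount T e a s = 0 := fun s h1 h2 h3 a ha =>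
    goldCount_eq_zero fun b => by rcases vc a ha b with h | h | h <;> rw [h] <;> lia
  have zn : ∀ s, s ≠ h → s ≠ -h → ∀ a : F, a ≠ 0 →
      (¬ ∃ u, a * u ^ (2 ^ e + 1) = 1) → goldCount T e a s = 0 := fun s h1 h2 a ha0 ha =>
    goldCount_eq_zero fun b => by rcases vn a ha0 ha b with h | h <;> rw [h] <;> lia
  have e1 : ∃ u : F, 1 * u ^ (2 ^ e + 1) = 1 := ⟨1, by simp⟩
  -- `M` clears the denominator of the individual counts and `6` that of the number `n` of
  -- power-type `a`: the coefficients of `c` and `d` are `6 (n - 1)` and `3 (q - 2n - 2)`.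
  have total : ∀ (s M c d : ℤ),
      (∀ a : F, traceSign F a = 1 → a ≠ 1 → (∃ u, a * u ^ (2 ^ e + 1) = 1) →
        M * goldCount T e a s = c) →
      (∀ a : F, traceSign F a = 1 → a ≠ 0 → (¬ ∃ u, a * u ^ (2 ^ e + 1) = 1) →
        M * goldCount T e a s = d) →
      6 * M * (goldTotal T e s : ℤ) = 6 * (M * goldCount T e (0 : F) s) +
        6 * (M * goldCount T e (1 : F) s) + (h ^ 2 - 2 * (ε * h) - 8) * c +
        (2 * h ^ 2 + 2 * (ε * h) - 4) * d := by
    intro s M c d h1 h2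
    have h3 := sum_traceSign_eq_one_split hF hm (fun a => M * (goldCount T e a s : ℤ)) c d h1 h2
    rw [hq, ← Finset.mul_sum] at h3
    rw [goldTotal]
    push_cast
    linear_combination 3 * h3 + (c - d) * hn
  refine ⟨?_, ?_, ?_, ?_, ?_, ?_, ?_⟩
  · have := total (h ^ 2) 1 0 0
      (fun a _ _ ha => by simp [zc (h ^ 2) (by lia) (by lia) (by lia) a ha])
      (fun a _ h0 ha => by simp [zn (h ^ 2) (by lia) (by lia) a h0 ha])
    rw [c0, zc (h ^ 2) (by lia) (by lia) (by lia) 1 e1] at this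
    push_cast at this
    lia
  · have := total (2 * h) 32 (h ^ 2 + 8 * h) 0
      (fun a ht h1 ha => (cc a h1 ht ha).1)
      (fun a _ h0 ha => by simp [zn (2 * h) (by lia) (by lia) a h0 ha])
    rw [z0 (2 * h) (by lia) (by lia)] at this
    push_cast at this
    linear_combination this + 24 * c1.1
  · have := total (-(2 * h)) 32 (h ^ 2 - 8 * h) 0
      (fun a ht h1 ha => (cc a h1 ht ha).2.1)
      (fun a _ h0 ha => by simp [zn (-(2 * h)) (by lia) (by lia) a h0 ha])
    rw [z0 (-(2 * h)) (by lia) (by lia)] at this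
    push_cast at this
    linear_combination this + 24 * c1.2.1
  · have := total h 8 0 (h ^ 2 + 4 * h)
      (fun a _ _ ha => by simp [zc h (by lia) (by lia) (by lia) a ha])
      (fun a ht h0 ha => (cn a h0 ht ha).1)
    rw [z0 h (by lia) (by lia), zc h (by lia) (by lia) (by lia) 1 e1] at this
    push_cast at this
    have h2 : 2 * (24 * (goldTotal T e h : ℤ)) =
        2 * ((h ^ 2 + ε * h - 2) * (h ^ 2 + 4 * h)) := by linear_combination this
    exact mul_left_cancel₀ two_ne_zero h2
  · have := total (-h) 8 0 (h ^ 2 - 4 * h)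
      (fun a _ _ ha => by simp [zc (-h) (by lia) (by lia) (by lia) a ha])
      (fun a ht h0 ha => (cn a h0 ht ha).2)
    rw [z0 (-h) (by lia) (by lia), zc (-h) (by lia) (by lia) (by lia) 1 e1] at this
    push_cast at this
    have h2 : 2 * (24 * (goldTotal T e (-h) : ℤ)) =
        2 * ((h ^ 2 + ε * h - 2) * (h ^ 2 - 4 * h)) := by linear_combination this
    exact mul_left_cancel₀ two_ne_zero h2
  · have := total 0 16 (3 * h ^ 2) 0
      (fun a ht h1 ha => (cc a h1 ht ha).2.2)
      (fun a _ h0 ha => by simp [zn 0 (by lia) (by lia) a h0 ha])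
    rw [c1.2.2] at this
    push_cast at this
    have h2 : 3 * (32 * (goldTotal T e 0 : ℤ)) = 3 * (h ^ 4 - 2 * ε * h ^ 3 - 32) := by
      linear_combination this + 24 * c00
    exact mul_left_cancel₀ three_ne_zero h2
  · intro s s1 s2 s3 s4 s5 s6
    have := total s 1 0 0
      (fun a _ _ ha => by simp [zc s s6 s2 s3 a ha])
      (fun a _ h0 ha => by simp [zn s s4 s5 a h0 ha])
    rw [z0 s s1 s6, zc s s6 s2 s3 1 e1] at this
    push_cast at this
    lia

end Totals

/-! ### From parameters `(a, b)` to words of the shortened code. -/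

section Code

theorem Subfield.mem_iff_pow_four_eq_self {F : Type*} [Field F] [Fintype F] [DecidableEq F]
    (K : Subfield F) (hK : Nat.card K = 4) (T : Finset F) (hT : (T : Set F) = (K : Set F)) :
    T.card = 4 ∧ ∀ x, x ∈ T ↔ x ^ 4 = x := by
  have hmem : ∀ x, x ∈ T ↔ x ∈ K := fun x => by
    rw [← Finset.mem_coe, hT, SetLike.mem_coe]
  have hTc : T.card = 4 := by
    rw [← Set.ncard_coe_finset, hT, ← hK]
    rfl
  refine ⟨hTc, fun x => ?_⟩
  have hsub : T ⊆ Finset.univ.filter fun x => x ^ 4 = x := by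
    intro y hy
    have : Fintype K := Fintype.ofFinite K
    have h := FiniteField.pow_card (⟨y, (hmem y).1 hy⟩ : K)
    rw [← Nat.card_eq_fintype_card, hK] at h
    rw [Finset.mem_filter]
    exact ⟨Finset.mem_univ y, congrArg Subtype.val h⟩
  have hcard : (Finset.univ.filter fun x : F => x ^ 4 = x).card ≤ T.card := by
    have hdeg := FiniteField.X_pow_card_sub_X_natDegree_eq F (p := 4) (by norm_num)
    refine (hdeg.trans hTc.symm) ▸ Polynomial.card_le_degree_of_subset_roots fun y hy => ?_
    rw [Finset.filter_val, Multiset.mem_filter] at hy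
    rw [Polynomial.mem_roots (FiniteField.X_pow_card_sub_X_ne_zero F (by norm_num))]
    simp [hy.2]
  rw [Finset.eq_of_subset_of_card_le hsub hcard]
  simp

variable {F : Type*} [Field F] [Algebra (ZMod 2) F]

/-- The word `(Tr (a x ^ (2 ^ e + 1) + b x))` on the positions outside `T`. -/
noncomputable def goldWord (T : Finset F) (e : ℕ) (p : F × F) : {x : F // x ∉ T} → ZMod 2 :=
  fun x => Algebra.trace (ZMod 2) F (p.1 * (x : F) ^ (2 ^ e + 1) + p.2 * x)

variable [Fintype F] [DecidableEq F]

/-- The parameters `(a, b)` of the words of the shortened code. -/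
noncomputable def goldParams (T : Finset F) : Finset (F × F) :=
  (Finset.univ.filter fun a : F => traceSign F a = 1) ×ˢ traceDual T

theorem mem_goldParams {T : Finset F} {p : F × F} :
    p ∈ goldParams T ↔ traceSign F p.1 = 1 ∧ p.2 ∈ traceDual T := by
  simp [goldParams]

theorem traceSign_goldParams {T : Finset F} (hT : ∀ x, x ∈ T ↔ x ^ 4 = x) {e : ℕ} (he : Odd e)
    {p : F × F} (hp : p ∈ goldParams T) {t : F} (ht : t ∈ T) :
    traceSign F (p.1 * t ^ (2 ^ e + 1) + p.2 * t) = 1 := by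
  rw [mem_goldParams] at hp
  rw [AddChar.map_add_eq_mul, traceSign_mul_pow_gold hT he hp.1 ht, mem_traceDual.1 hp.2 t ht,
    mul_one]

theorem goldParams_of_vanishing [CharP F 2] {T : Finset F} (hT : ∀ x, x ∈ T ↔ x ^ 4 = x)
    (hTc : T.card = 4) {e : ℕ} (he : Odd e) {a b c : F}
    (h : ∀ t ∈ T, traceSign F (a * t ^ (2 ^ e + 1) + b * t + c) = 1) :
    (a, b) ∈ goldParams T ∧ traceSign F c = 1 := by
  have h0T : (0 : F) ∈ T := (hT 0).2 (by simp)
  have hc : traceSign F c = 1 := by simpa using h 0 h0T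
  have h1 : ∀ t ∈ T, t ≠ 0 → traceSign F a * traceSign F (b * t) = 1 := by
    intro t ht ht0
    have := h t ht
    rwa [AddChar.map_add_eq_mul, hc, mul_one, AddChar.map_add_eq_mul,
      pow_gold_eq_one_of_pow_four_eq_self he ht0 ((hT t).1 ht), mul_one] at this
  have ha : traceSign F a = 1 := by
    have hlt : 1 < (T.erase 0).card := by rw [Finset.card_erase_of_mem h0T, hTc]; norm_num
    obtain ⟨s, hs, t, ht, hst⟩ := Finset.one_lt_card.1 hlt
    rw [Finset.mem_erase] at hs ht
    -- If `Tr a = 1`, the character of `b` would be `-1` at `s`, `t` and `s + t`, against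
    -- multiplicativity.
    have h4 : (s + t) ^ 4 = s ^ 4 + t ^ 4 := add_pow_char_pow (p := 2) (n := 2) s t
    have hmem : s + t ∈ T := by rw [hT, h4, (hT s).1 hs.2, (hT t).1 ht.2]
    have hne : s + t ≠ 0 := by rwa [Ne, CharTwo.add_eq_zero]
    have es := h1 s hs.2 hs.1
    have et := h1 t ht.2 ht.1
    have est := h1 _ hmem hne
    rw [mul_add, AddChar.map_add_eq_mul] at est
    rcases traceSign_eq_or a with h | h
    · exact h
    · rw [h] at es et est
      have e1 : traceSign F (b * s) = -1 := by linarith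
      have e2 : traceSign F (b * t) = -1 := by linarith
      rw [e1, e2] at est
      norm_num at est
  refine ⟨mem_goldParams.2 ⟨ha, mem_traceDual.2 fun t ht => ?_⟩, hc⟩
  rcases eq_or_ne t 0 with rfl | ht0
  · simp
  · simpa [ha] using h1 t ht ht0

theorem mem_shortenedCode_iff [CharP F 2] {T : Finset F} (hT : ∀ x, x ∈ T ↔ x ^ 4 = x)
    (hTc : T.card = 4) {e : ℕ} (he : Odd e) (w : {x : F // x ∉ T} → ZMod 2) :
    w ∈ shortenedCode (traceCode 2 (Polynomial.X ^ (2 ^ e + 1) : Polynomial F)) T ↔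
      ∃ p ∈ goldParams T, goldWord T e p = w := by
  constructor
  · rintro ⟨v, ⟨⟨a, b, c, rfl⟩, hv⟩, rfl⟩
    obtain ⟨hp, hc⟩ := goldParams_of_vanishing hT hTc he (a := a) (b := b) (c := c)
      fun t ht => by
        rw [traceSign_eq_one_iff]
        simpa using hv t ht
    refine ⟨(a, b), hp, funext fun x => ?_⟩
    rw [traceSign_eq_one_iff] at hc
    simp [goldWord, LinearMap.funLeft_apply, hc]
  · rintro ⟨p, hp, rfl⟩
    refine ⟨fun x => Algebra.trace (ZMod 2) F (p.1 * x ^ (2 ^ e + 1) + p.2 * x), ⟨?_, ?_⟩, ?_⟩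
    · exact ⟨p.1, p.2, 0, by simp⟩
    · intro t ht
      rw [← traceSign_eq_one_iff]
      exact traceSign_goldParams hT he hp ht
    · rfl

/-- The deleted coordinates are all zero, so the weight may be computed on all of `F`. -/
theorem goldSum_eq_card_sub {T : Finset F} (hT : ∀ x, x ∈ T ↔ x ^ 4 = x) {e : ℕ} (he : Odd e)
    {p : F × F} (hp : p ∈ goldParams T) :
    goldSum e p.1 p.2 = Fintype.card F - 2 * hammingNorm (goldWord T e p) := by
  have h : hammingNorm (goldWord T e p) = (Finset.univ.filter fun x : F =>
      ¬ traceSign F (p.1 * x ^ (2 ^ e + 1) + p.2 * x) = 1).card := by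
    rw [hammingNorm, ← Finset.card_map (Function.Embedding.subtype fun x : F => x ∉ T)]
    congr 1
    ext x
    rw [Finset.mem_map, Finset.mem_filter, traceSign_eq_one_iff]
    constructor
    · rintro ⟨y, hy, rfl⟩
      exact ⟨Finset.mem_univ _, (Finset.mem_filter.1 hy).2⟩
    · rintro ⟨-, hx⟩
      refine ⟨⟨x, fun hxT => hx ?_⟩, Finset.mem_filter.2 ⟨Finset.mem_univ _, hx⟩, rfl⟩
      rw [← traceSign_eq_one_iff]
      exact traceSign_goldParams hT he hp hxT
  have h2 := Finset.card_filter_add_card_filter_not (s := (Finset.univ : Finset F))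
    fun x => traceSign F (p.1 * x ^ (2 ^ e + 1) + p.2 * x) = 1
  rw [Finset.card_univ, ← h] at h2
  rw [goldSum, sum_traceSign_comp]
  lia

theorem card_goldParams_filter (T : Finset F) (e : ℕ) (s : ℤ) :
    ((goldParams T).filter fun p => goldSum e p.1 p.2 = s).card = goldTotal T e s := by
  rw [goldParams, Finset.card_filter, Finset.sum_product, goldTotal]
  refine Finset.sum_congr rfl fun a _ => ?_
  rw [goldCount, Finset.card_filter]

theorem two_mul_four_mul_card_goldParams [CharP F 2] {T : Finset F}
    (hT : ∀ x, x ∈ T ↔ x ^ 4 = x) (hTc : T.card = 4) :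
    2 * 4 * (goldParams T).card = Fintype.card F ^ 2 := by
  have h1 := two_mul_card_traceSign_eq_one (F := F)
  have h2 := card_mul_card_traceDual hT
  rw [hTc] at h2
  rw [goldParams, Finset.card_product, mul_mul_mul_comm, h2, sq]
  congr 1
  exact_mod_cast h1

/-- Equal words make the sum of the parameters a pair with `S = q`, and only `(0, 0)` is one. -/
theorem injOn_goldWord [CharP F 2] {T : Finset F} (hT : ∀ x, x ∈ T ↔ x ^ 4 = x)
    {e : ℕ} (he : Odd e) (h1 : goldTotal T e (Fintype.card F) = 1) :
    Set.InjOn (goldWord T e) (goldParams T : Set (F × F)) := by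
  intro p hp p' hp' hpp
  rw [Finset.mem_coe] at hp hp'
  have hsub : p + p' ∈ goldParams T := by
    rw [mem_goldParams, mem_traceDual] at *
    refine ⟨?_, fun t ht => ?_⟩
    · rw [Prod.fst_add, AddChar.map_add_eq_mul, hp.1, hp'.1, mul_one]
    · rw [Prod.snd_add, add_mul, AddChar.map_add_eq_mul, hp.2 t ht, hp'.2 t ht, mul_one]
  have hword : goldWord T e (p + p') = 0 := by
    have h2 : goldWord T e (p + p') = goldWord T e p + goldWord T e p' := by
      funext x
      simp only [goldWord, Pi.add_apply, Prod.fst_add, Prod.snd_add, ← map_add]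
      congr 1
      ring
    rw [h2, hpp]
    funext x
    exact CharTwo.add_self_eq_zero _
  have hs := goldSum_eq_card_sub hT he hsub
  rw [hword, hammingNorm_zero, Nat.cast_zero, mul_zero, sub_zero] at hs
  have h0 : (0 : F × F) ∈ goldParams T := by
    simp [mem_goldParams, zero_mem_traceDual]
  have hs0 : goldSum e (0 : F × F).1 (0 : F × F).2 = Fintype.card F := by
    rw [Prod.fst_zero, Prod.snd_zero, goldSum_zero_left, if_pos rfl]
  rw [← card_goldParams_filter] at h1
  have h3 := Finset.card_le_one.1 h1.le (p + p') (Finset.mem_filter.2 ⟨hsub, hs⟩) 0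
    (Finset.mem_filter.2 ⟨h0, hs0⟩)
  rw [Prod.ext_iff] at h3 ⊢
  exact ⟨CharTwo.add_eq_zero.1 h3.1, CharTwo.add_eq_zero.1 h3.2⟩

theorem weightMultiplicity_shortenedCode [CharP F 2] {T : Finset F}
    (hT : ∀ x, x ∈ T ↔ x ^ 4 = x) (hTc : T.card = 4) {e : ℕ} (he : Odd e)
    (h1 : goldTotal T e (Fintype.card F) = 1) (w : ℕ) :
    weightMultiplicity
      (shortenedCode (traceCode 2 (Polynomial.X ^ (2 ^ e + 1) : Polynomial F)) T) w =
      goldTotal T e (Fintype.card F - 2 * w) := by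
  rw [weightMultiplicity, ← card_goldParams_filter, ← Set.ncard_coe_finset]
  have hinj : Set.InjOn (goldWord T e) ((goldParams T).filter fun p =>
      goldSum e p.1 p.2 = Fintype.card F - 2 * w : Finset (F × F)) :=
    (injOn_goldWord hT he h1).mono (Finset.coe_subset.2 (Finset.filter_subset _ _))
  rw [← hinj.ncard_image]
  congr 1
  ext v
  simp only [Set.mem_ofPred_eq, mem_shortenedCode_iff hT hTc he, Set.mem_image, Finset.mem_coe,
    Finset.mem_filter]
  constructor
  · rintro ⟨⟨p, hp, rfl⟩, hw⟩
    exact ⟨p, ⟨hp, by rw [goldSum_eq_card_sub hT he hp, hw]⟩, rfl⟩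
  · rintro ⟨p, ⟨hp, hs⟩, rfl⟩
    rw [goldSum_eq_card_sub hT he hp] at hs
    exact ⟨⟨p, hp, rfl⟩, by lia⟩

theorem two_pow_finrank_shortenedCode [CharP F 2] {T : Finset F}
    (hT : ∀ x, x ∈ T ↔ x ^ 4 = x) (hTc : T.card = 4) {e : ℕ} (he : Odd e)
    (h1 : goldTotal T e (Fintype.card F) = 1) :
    2 ^ Module.finrank (ZMod 2)
      (shortenedCode (traceCode 2 (Polynomial.X ^ (2 ^ e + 1) : Polynomial F)) T) =
      (goldParams T).card := by
  have h := Module.natCard_eq_pow_finrank (K := ZMod 2)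
    (V := shortenedCode (traceCode 2 (Polynomial.X ^ (2 ^ e + 1) : Polynomial F)) T)
  rw [Nat.card_zmod] at h
  rw [← h, ← Set.ncard_coe_finset, ← (injOn_goldWord hT he h1).ncard_image]
  change Set.ncard (_ : Set _) = _
  congr 1
  ext v
  exact mem_shortenedCode_iff hT hTc he v

end Code

/-! ### Minimum distance and the final weight distribution. -/

theorem isLeast_hammingDist_of_weightMultiplicity {R ι : Type*} [Field R] [DecidableEq R]
    [Fintype ι] [Finite R] (C : Submodule R (ι → R)) {d : ℕ} (hd : d ≠ 0)
    (h1 : weightMultiplicity C d ≠ 0) (h2 : ∀ w, w ≠ 0 → w < d → weightMultiplicity C w = 0) :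
    IsLeast {δ : ℕ | ∃ u ∈ C, ∃ v ∈ C, u ≠ v ∧ hammingDist u v = δ} d := by
  constructor
  · obtain ⟨u, hu, hud⟩ := Set.nonempty_of_ncard_ne_zero h1
    refine ⟨u, hu, 0, C.zero_mem, ?_, ?_⟩
    · rintro rfl
      exact hd (by rw [← hud, hammingNorm_zero])
    · rw [hammingDist_zero_right, hud]
  · rintro δ ⟨u, hu, v, hv, huv, rfl⟩
    by_contra! hlt
    have h3 := h2 _ (hammingDist_ne_zero.2 huv) hlt
    rw [weightMultiplicity, Set.ncard_eq_zero (Set.toFinite _)] at h3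
    have h4 : -u + v ∈ {x | x ∈ C ∧ hammingNorm x = hammingDist u v} :=
      ⟨C.add_mem (C.neg_mem hu) hv, (hammingDist_eq_hammingNorm u v).symm⟩
    rw [h3] at h4
    exact h4

theorem gold_min_weight_count_pos {h ε : ℤ} (hh : 4 ≤ h) (hε : ε ≤ 1) :
    0 < 24 * (h ^ 2 + 2 * h) + (h ^ 2 - 2 * (ε * h) - 8) * (h ^ 2 + 8 * h) := by
  -- This product is `h ^ 2 - 2 * h - 8`, the worst case `ε = 1` of the second factor.
  have h1 : 0 ≤ (h - 4) * (h + 2) := mul_nonneg (by lia) (by lia)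
  have h2 : 0 ≤ (1 - ε) * h := mul_nonneg (by lia) (by lia)
  have h3 : 0 ≤ h ^ 2 - 2 * (ε * h) - 8 := by linarith
  positivity

theorem mainTheorem3 {F : Type*} [Field F] [Fintype F] [DecidableEq F] [Algebra (ZMod 2) F]
    (m e : ℕ) (hm : 4 ≤ m) (hm_even : Even m) (he : 0 < e) (hme : Nat.gcd m e = 1)
    (hF : Fintype.card F = 2 ^ m)
    (K : Subfield F) (hK : Nat.card K = 4) (T : Finset F) (hT : (T : Set F) = (K : Set F))
    (C : Submodule (ZMod 2) (F → ZMod 2))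
    (hC : C = traceCode 2 (Polynomial.X ^ (2 ^ e + 1) : Polynomial F))
    (A : ℕ → ℕ) (hA : ∀ w, A w = weightMultiplicity (shortenedCode C T) w) :
    HasCodeParameters (shortenedCode C T) (2 ^ m - 4) (2 * m - 3) (2 ^ (m - 1) - 2 ^ (m / 2)) ∧
    A 0 = 1 ∧
    (A (2 ^ (m - 1) - 2 ^ (m / 2)) : ℚ) =
      1 / 3 * (2 : ℚ) ^ (((m / 2 : ℕ) : ℤ) - 6) *
        (-16 + 2 ^ (3 * m / 2) - 2 ^ (m + 1) * (-4 + (-1) ^ (m / 2))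
          - 2 ^ (4 + m / 2) * (-1 + (-1) ^ (m / 2))) ∧
    (A (2 ^ (m - 1) - 2 ^ ((m - 2) / 2)) : ℚ) =
      1 / 24 * (2 ^ (m / 2 + 2) + 2 ^ m) * (2 ^ m + (-1) ^ (m / 2) * 2 ^ (m / 2) - 2) ∧
    (A (2 ^ (m - 1)) : ℚ) = -1 + 2 ^ (2 * m - 5) - (-1) ^ (m / 2) * 2 ^ (3 * m / 2 - 4) ∧
    (A (2 ^ (m - 1) + 2 ^ ((m - 2) / 2)) : ℚ) =
      1 / 24 * (-2 ^ (m / 2 + 2) + 2 ^ m) * (2 ^ m + (-1) ^ (m / 2) * 2 ^ (m / 2) - 2) ∧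
    (A (2 ^ (m - 1) + 2 ^ (m / 2)) : ℚ) =
      1 / 3 * (2 : ℚ) ^ (((m / 2 : ℕ) : ℤ) - 6) *
        (16 + 2 ^ (3 * m / 2) - 2 ^ (m + 1) * (4 + (-1) ^ (m / 2))
          + 2 ^ (4 + m / 2) * (1 + (-1) ^ (m / 2))) ∧
    ∀ w : ℕ, w ∉ ({0, 2 ^ (m - 1) - 2 ^ (m / 2), 2 ^ (m - 1) - 2 ^ ((m - 2) / 2), 2 ^ (m - 1),
        2 ^ (m - 1) + 2 ^ ((m - 2) / 2), 2 ^ (m - 1) + 2 ^ (m / 2)} : Set ℕ) → A w = 0 := by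
  subst hC
  obtain ⟨hTc, hT4⟩ := Subfield.mem_iff_pow_four_eq_self K hK T hT
  have : CharP F 2 := charP_of_injective_algebraMap (algebraMap (ZMod 2) F).injective 2
  obtain ⟨k, rfl⟩ := hm_even.two_dvd
  have hodd : Odd e := by
    rw [← Nat.not_even_iff_odd, even_iff_two_dvd]
    intro h
    have := Nat.dvd_gcd (dvd_mul_right 2 k) h
    rw [hme] at this
    norm_num at this
  have hk : 2 ≤ k := by lia
  obtain ⟨t0, tp2, tm2, tp1, tm1, tz, tother⟩ :=
    goldTotal_values hT4 hTc hk hF hodd hme (h := 2 ^ k) (ε := (-1) ^ k) rfl rfl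
  have hq : (Fintype.card F : ℤ) = (2 ^ k) ^ 2 := by
    rw [hF, mul_comm, pow_mul]; push_cast; rfl
  have h1 : goldTotal T e (Fintype.card F) = 1 := hq ▸ t0
  have hAw : ∀ w, A w = goldTotal T e (Fintype.card F - 2 * w) := fun w =>
    (hA w).trans (weightMultiplicity_shortenedCode hT4 hTc hodd h1 w)
  -- With `m = 2 * j + 4`, every truncated subtraction and division in the exponents becomes exact.
  obtain ⟨j, rfl⟩ : ∃ j, k = j + 2 := ⟨k - 2, by lia⟩
  have e1 : 2 * (j + 2) / 2 = j + 2 := by lia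
  have e2 : (2 * (j + 2) - 2) / 2 = j + 1 := by lia
  have e3 : 2 * (j + 2) - 1 = 2 * j + 3 := by lia
  have e4 : 3 * (2 * (j + 2)) / 2 = 3 * j + 6 := by lia
  have e5 : 3 * j + 6 - 4 = 3 * j + 2 := by lia
  have e6 : 2 * (2 * (j + 2)) - 5 = 4 * j + 3 := by lia
  have e7 : 2 * (2 * (j + 2)) - 3 = 4 * j + 5 := by lia
  rw [e1, e2, e3, e4, e5, e6, e7]
  have p1 : 2 ^ (j + 2) = 4 * 2 ^ j := by ring
  have p2 : 2 ^ (j + 1) = 2 * 2 ^ j := by ring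
  have p3 : 2 ^ (2 * j + 3) = 8 * (2 ^ j) ^ 2 := by ring
  have p4 : 2 ^ (2 * (j + 2)) = 16 * (2 ^ j) ^ 2 := by ring
  have hx : 1 ≤ 2 ^ j := Nat.one_le_two_pow
  have hxx : 2 ^ j ≤ (2 ^ j) ^ 2 := Nat.le_self_pow two_ne_zero _
  have hz : ((2 : ℤ) ^ (j + 2)) = 4 * (2 ^ j : ℕ) := by push_cast; ring
  have hzq : ((2 : ℤ) ^ (j + 2)) ^ 2 = 16 * ((2 ^ j) ^ 2 : ℕ) := by push_cast; ring
  have hAp2 : A (2 ^ (2 * j + 3) - 2 ^ (j + 2)) = goldTotal T e (2 * 2 ^ (j + 2)) := by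
    rw [hAw, hq]; congr 1; lia
  have hAm2 : A (2 ^ (2 * j + 3) + 2 ^ (j + 2)) = goldTotal T e (-(2 * 2 ^ (j + 2))) := by
    rw [hAw, hq]; congr 1; lia
  have hAp1 : A (2 ^ (2 * j + 3) - 2 ^ (j + 1)) = goldTotal T e (2 ^ (j + 2)) := by
    rw [hAw, hq]; congr 1; lia
  have hAm1 : A (2 ^ (2 * j + 3) + 2 ^ (j + 1)) = goldTotal T e (-2 ^ (j + 2)) := by
    rw [hAw, hq]; congr 1; lia
  have hAz : A (2 ^ (2 * j + 3)) = goldTotal T e 0 := by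
    rw [hAw, hq]; congr 1; lia
  have hA0 : A 0 = 1 := by rw [hAw, Nat.cast_zero, mul_zero, sub_zero, h1]
  have hother : ∀ w : ℕ, w ∉ ({0, 2 ^ (2 * j + 3) - 2 ^ (j + 2), 2 ^ (2 * j + 3) - 2 ^ (j + 1),
      2 ^ (2 * j + 3), 2 ^ (2 * j + 3) + 2 ^ (j + 1), 2 ^ (2 * j + 3) + 2 ^ (j + 2)} : Set ℕ) →
      A w = 0 := by
    intro w hw
    simp only [Set.mem_insert_iff, Set.mem_singleton_iff, not_or] at hw
    rw [hAw, hq]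
    apply tother <;> lia
  have hz6 : (2 : ℚ) ^ (((j + 2 : ℕ) : ℤ) - 6) = 2 ^ (j + 2) / 64 := by
    rw [zpow_sub₀ two_ne_zero, zpow_natCast]
    norm_num
  refine ⟨⟨?_, ?_, ?_⟩, hA0, ?_, ?_, ?_, ?_, ?_, hother⟩
  · rw [Fintype.card_subtype_compl, hF, Fintype.card_coe, hTc]
  · have hr := two_pow_finrank_shortenedCode hT4 hTc hodd h1
    have hc := two_mul_four_mul_card_goldParams hT4 hTc
    rw [← hr, hF] at hc
    apply Nat.pow_right_injective le_rfl
    -- The factor `2` is the index of `Tr a = 0`, and `4` that of the trace dual.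
    apply Nat.eq_of_mul_eq_mul_left (show 0 < 2 * 4 by norm_num)
    refine hc.trans ?_
    ring
  · refine isLeast_hammingDist_of_weightMultiplicity _ (by lia) ?_ fun w hw hlt => ?_
    · rw [← hA, hAp2]
      intro h0
      rw [h0] at tp2
      have h4 : (4 : ℤ) ≤ 2 ^ (j + 2) := by lia
      have hε : (-1 : ℤ) ^ (j + 2) ≤ 1 := by
        rcases neg_one_pow_eq_or ℤ (j + 2) with h | h <;> simp [h]
      have h6 := gold_min_weight_count_pos h4 hε
      rw [← tp2] at h6
      norm_num at h6
    · rw [← hA]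
      apply hother
      simp only [Set.mem_insert_iff, Set.mem_singleton_iff, not_or]
      lia
  · rw [hAp2, hz6]
    have := congrArg (Int.cast : ℤ → ℚ) tp2
    push_cast at this
    linear_combination this / 192
  · rw [hAp1]
    have := congrArg (Int.cast : ℤ → ℚ) tp1
    push_cast at this
    linear_combination this / 24
  · rw [hAz]
    have := congrArg (Int.cast : ℤ → ℚ) tz
    push_cast at this
    linear_combination this / 32
  · rw [hAm1]
    have := congrArg (Int.cast : ℤ → ℚ) tm1
    push_cast at this
    linear_combination this / 24
  · rw [hAm2, hz6]
    have := congrArg (Int.cast : ℤ → ℚ) tm2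
    push_cast at this
    linear_combination this / 192
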